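/- Let $D$ be a division ring whose center $F$ is infinite, and let $F\langle \mathcal X\rangle$ be the free associative $F$-algebra on $\mathcal X=\{x_1,x_2,\dots\}$. For a division ring $K$, let $\mathrm M_\infty(K)=\bigcup_{n\ge 1}\mathrm M_n(K)$ be the algebra of finitary matrices (matrices indexed by $\mathbb N\times\mathbb N$ with only finitely many nonzero entries), where $\mathrm M_n(K)\subseteq \mathrm M_{n+1}(K)$ via $A\mapsto A\oplus(0)$. For a polynomial $f\in F\langle\mathcal X\rangle$ with zero constant term and an associative, not necessarily unital $F$-algebra $\mathcal A$, let $f(\mathcal A)$ be the set of all values of $f$ under substitution of elements of $\mathcal A$ for the variables. A polynomial $f\in F\langle\mathcal X\rangle$ is multilinear in the distinct variables $x_{i_1},\dots,x_{i_m}$ ($m\ge 1$) if $f=\sum_{\sigma\in S_m}\lambda_\sigma\, x_{i_{\sigma(1)}}\cdots x_{i_{\sigma(m)}}$ with $\lambda_\sigma\in F$. Let $p=p_1p_2\in F\langle\mathcal X\rangle$, where $p_1,p_2\in F\langle\mathcal X\rangle$ are multilinear in disjoint sets of variables and $p_1(\mathrm M_\infty(F))\ne\{0\}$, $p_2(\mathrm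 M_\infty(F))\ne\{0\}$. Then $$p(\mathrm M_\infty(D))=\mathrm M_\infty(D).$$ -/

import Mathlib

/-- `M_∞(R)`: matrices with rows and columns indexed by `ℕ` that vanish outside the upper left
`n × n` block for some `n`, i.e. the union of the chain `M_1(R) ⊆ M_2(R) ⊆ ⋯` under
`A ↦ A ⊕ (0)`. -/
def FinitaryMatrix (R : Type*) [Zero R] : Type _ :=
  {A : Matrix ℕ ℕ R // ∃ n : ℕ, ∀ i j, (n ≤ i ∨ n ≤ j) → A i j = 0}

namespace FinitaryMatrix

section

variable {R : Type*} [Ring R]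

/-- The entry of a finitary matrix in row `i` and column `j`. -/
def entry (A : FinitaryMatrix R) (i j : ℕ) : R := A.1 i j

theorem ext_entry {A B : FinitaryMatrix R} (h : ∀ i j, A.entry i j = B.entry i j) : A = B :=
  Subtype.ext (funext fun i => funext fun j => h i j)

/-- Addition, negation, subtraction, zero: entrywise. -/
instance : Zero (FinitaryMatrix R) := ⟨⟨fun _ _ => 0, 0, fun _ _ _ => rfl⟩⟩

instance : Add (FinitaryMatrix R) :=
  ⟨fun A B => ⟨fun i j => A.entry i j + B.entry i j, by
    obtain ⟨n, hn⟩ := A.2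
    obtain ⟨m, hm⟩ := B.2
    refine ⟨max n m, fun i j h => ?_⟩
    show A.1 i j + B.1 i j = 0
    rw [hn i j (by omega), hm i j (by omega), add_zero]⟩⟩

instance : Neg (FinitaryMatrix R) :=
  ⟨fun A => ⟨fun i j => -A.entry i j, by
    obtain ⟨n, hn⟩ := A.2
    refine ⟨n, fun i j h => ?_⟩
    show -A.1 i j = 0
    rw [hn i j h, neg_zero]⟩⟩

/-- Matrix multiplication; in every entry only finitely many summands are nonzero. -/
noncomputable instance : Mul (FinitaryMatrix R) :=
  ⟨fun A B => ⟨fun i j => ∑ᶠ k, A.entry i k * B.entry k j, by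
    obtain ⟨n, hn⟩ := A.2
    obtain ⟨m, hm⟩ := B.2
    refine ⟨max n m, fun i j h => ?_⟩
    show (∑ᶠ k, A.1 i k * B.1 k j) = 0
    refine finsum_eq_zero_of_forall_eq_zero fun k => ?_
    rcases h with h | h
    · rw [hn i k (by omega), zero_mul]
    · rw [hm k j (by omega), mul_zero]⟩⟩

/-- Scalars act entrywise. -/
instance {S : Type*} [SMulZeroClass S R] : SMul S (FinitaryMatrix R) :=
  ⟨fun c A => ⟨fun i j => c • A.entry i j, by
    obtain ⟨n, hn⟩ := A.2
    refine ⟨n, fun i j h => ?_⟩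
    show c • A.1 i j = 0
    rw [hn i j h, smul_zero]⟩⟩

@[simp] theorem entry_zero (i j : ℕ) : (0 : FinitaryMatrix R).entry i j = 0 := rfl

@[simp] theorem entry_add (A B : FinitaryMatrix R) (i j : ℕ) :
    (A + B).entry i j = A.entry i j + B.entry i j := rfl

@[simp] theorem entry_neg (A : FinitaryMatrix R) (i j : ℕ) : (-A).entry i j = -A.entry i j := rfl

@[simp] theorem entry_smul {S : Type*} [SMulZeroClass S R] (c : S) (A : FinitaryMatrix R)
    (i j : ℕ) : (c • A).entry i j = c • A.entry i j := rfl

theorem entry_mul (A B : FinitaryMatrix R) (i j : ℕ) :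
    (A * B).entry i j = ∑ᶠ k, A.entry i k * B.entry k j := rfl

theorem exists_bound (A : FinitaryMatrix R) :
    ∃ n : ℕ, ∀ i j, (n ≤ i ∨ n ≤ j) → A.entry i j = 0 := A.2

theorem entry_mul_of_left {n : ℕ} {A : FinitaryMatrix R}
    (hA : ∀ i j, (n ≤ i ∨ n ≤ j) → A.entry i j = 0) (B : FinitaryMatrix R) (i j : ℕ) :
    (A * B).entry i j = ∑ k ∈ Finset.range n, A.entry i k * B.entry k j := by
  rw [entry_mul]
  refine finsum_eq_sum_of_support_subset _ fun k hk => ?_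
  by_contra h
  refine hk ?_
  show A.entry i k * B.entry k j = 0
  rw [hA i k (Or.inr (by simpa using h)), zero_mul]

theorem entry_mul_of_right {n : ℕ} (A : FinitaryMatrix R) {B : FinitaryMatrix R}
    (hB : ∀ i j, (n ≤ i ∨ n ≤ j) → B.entry i j = 0) (i j : ℕ) :
    (A * B).entry i j = ∑ k ∈ Finset.range n, A.entry i k * B.entry k j := by
  rw [entry_mul]
  refine finsum_eq_sum_of_support_subset _ fun k hk => ?_
  by_contra h
  refine hk ?_
  show A.entry i k * B.entry k j = 0
  rw [hB k j (Or.inl (by simpa using h)), mul_zero]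

noncomputable instance : NonUnitalRing (FinitaryMatrix R) where
  add_assoc A B C := ext_entry fun i j => by simp [add_assoc]
  zero_add A := ext_entry fun i j => by simp
  add_zero A := ext_entry fun i j => by simp
  add_comm A B := ext_entry fun i j => by simp [add_comm]
  neg_add_cancel A := ext_entry fun i j => by simp
  nsmul n A := n • A
  nsmul_zero A := ext_entry fun i j => by simp
  nsmul_succ n A := ext_entry fun i j => by simp [add_mul]
  zsmul n A := n • A
  zsmul_zero' A := ext_entry fun i j => by simp
  zsmul_succ' n A := ext_entry fun i j => by simp [add_mul]
  zsmul_neg' n A := ext_entry fun i j => by simp [add_mul, add_comm]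
  zero_mul A := ext_entry fun i j => by simp [entry_mul]
  mul_zero A := ext_entry fun i j => by simp [entry_mul]
  left_distrib A B C := ext_entry fun i j => by
    obtain ⟨n, hn⟩ := A.exists_bound
    simp [entry_mul_of_left hn, mul_add, Finset.sum_add_distrib]
  right_distrib A B C := ext_entry fun i j => by
    obtain ⟨n, hn⟩ := C.exists_bound
    simp [entry_mul_of_right _ hn, add_mul, Finset.sum_add_distrib]
  mul_assoc A B C := ext_entry fun i j => by
    obtain ⟨n, hn⟩ := A.exists_bound
    obtain ⟨m, hm⟩ := C.exists_bound
    simp only [entry_mul_of_left hn, entry_mul_of_right _ hm, Finset.sum_mul, Finset.mul_sum,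
      mul_assoc]
    exact Finset.sum_comm

/-- `M_∞(R)` is an algebra over `F` whenever `R` is one (associativity, without a unit, is the
pair of instances that follow this one). -/
instance {F : Type*} [CommSemiring F] [Algebra F R] : Module F (FinitaryMatrix R) where
  one_smul A := ext_entry fun i j => by simp
  mul_smul a b A := ext_entry fun i j => by simp [mul_smul]
  smul_zero a := ext_entry fun i j => by simp
  smul_add a A B := ext_entry fun i j => by simp
  add_smul a b A := ext_entry fun i j => by simp [add_smul]
  zero_smul A := ext_entry fun i j => by simp

instance {F : Type*} [CommSemiring F] [Algebra F R] :
    IsScalarTower F (FinitaryMatrix R) (FinitaryMatrix R) where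
  smul_assoc a A B := ext_entry fun i j => by
    obtain ⟨n, hn⟩ := B.exists_bound
    simp [smul_eq_mul, entry_mul_of_right _ hn, Finset.smul_sum]

instance {F : Type*} [CommSemiring F] [Algebra F R] :
    SMulCommClass F (FinitaryMatrix R) (FinitaryMatrix R) where
  smul_comm a A B := ext_entry fun i j => by
    obtain ⟨n, hn⟩ := A.exists_bound
    simp [smul_eq_mul, entry_mul_of_left hn, Finset.smul_sum]

end

end FinitaryMatrix

/-- The image `p(A)` of a noncommutative polynomial `p ∈ F⟨x_0, x_1, …⟩` on an associative, not
necessarily unital `F`-algebra `A`: the set of all values `p(v_0, v_1, …)` with `v_i ∈ A`. As `A`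
need not have a unit, the value is computed in the unitization `F ⊕ A`. It lies in `A` if `p` has
zero constant term, which is the only case in which `p(A)` is meant to be used. -/
def polyImage {F : Type*} [Field F] (p : FreeAlgebra F ℕ) (A : Type*) [NonUnitalRing A]
    [Module F A] [IsScalarTower F A A] [SMulCommClass F A A] : Set A :=
  {a | ∃ v : ℕ → A, FreeAlgebra.lift F (fun i => (v i : Unitization F A)) p = a}

/-- `p` is multilinear in the (finite, nonempty) set of variables `{x_s : s ∈ S}`: it is a linear
combination `∑ c_σ x_{σ(1)} ⋯ x_{σ(m)}`, where `m = |S|` and `σ` runs over all enumerations of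
`S`. -/
def IsMultilinearIn {F : Type*} [Field F] (S : Finset ℕ) (p : FreeAlgebra F ℕ) : Prop :=
  S.Nonempty ∧ ∃ c : (Fin S.card ≃ S) → F,
    p = ∑ σ, c σ • (List.ofFn fun i => FreeAlgebra.ι F ((σ i : S) : ℕ)).prod

/-!
Any nonzero multilinear polynomial of degree `m` can be evaluated along a path. Suppose the
monomial `x_{σ(1)} ⋯ x_{σ(m)}` has coefficient `c ≠ 0`, let `e a b` be a system of matrix units, and
let `s 0, …, s m` be distinct indices. Substituting `e (s i) (s (i + 1))` for the `i`-th factor of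
this monomial annihilates every other monomial, since two edges of the path multiply to zero unless
they are consecutive (`prod_ofFn_comp_perm_eq_zero`). Multiplying the first edge on the left by
`c⁻¹ • B`, where `B` lies in the row of `s 0`, the polynomial takes the value `B * e (s 0) (s m)`
(`IsMultilinearIn.exists_lift_eq`).

In `M_∞(D)` there is room for such a system whose members are `n × n` blocks, with `n` so large that
a given matrix `A` lives in the block `(0, 0)` (`FinitaryMatrix.blockUnit`). Then `p₁` takes the
value `A * e 0 m` along the path `0, 1, …, m`, and `p₂` takes the value `e m 0` along a path that
returns from `m` to `0`. As the variables are disjoint, `p₁ * p₂` takes the value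
`A * e 0 m * e m 0 = A`.
-/

/-! ### Products along a path -/

/-- If only consecutive members of `w` can have a nonzero product, then a product of all members of
`w` in any other than the given order vanishes. -/
theorem prod_ofFn_comp_perm_eq_zero {M : Type*} [MonoidWithZero M] {m : ℕ} (w : Fin m → M)
    (hw : ∀ i j : Fin m, (j : ℕ) ≠ i + 1 → w i * w j = 0) (τ : Equiv.Perm (Fin m)) (hτ : τ ≠ 1) :
    (List.ofFn fun i => w (τ i)).prod = 0 := by
  -- Some two neighbouring positions carry nonconsecutive indices: otherwise `τ` is monotone.
  obtain ⟨k, hk, hne⟩ : ∃ k, ∃ hk : k + 1 < m,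
      (τ ⟨k + 1, hk⟩ : ℕ) ≠ τ ⟨k, by omega⟩ + 1 := by
    by_contra! hcon
    refine hτ ?_
    cases m with
    | zero => exact Subsingleton.elim _ _
    | succ m =>
      have hmono : StrictMono τ := Fin.strictMono_iff_lt_succ.2 fun i => by
        have := hcon i (by omega)
        rw [Fin.lt_def]
        change (τ ⟨i, _⟩ : ℕ) < τ ⟨i + 1, _⟩
        omega
      exact Equiv.ext fun i => congrFun (hmono.range_inj strictMono_id |>.1 (by simp)) i
  have hsplit : (List.ofFn fun i => w (τ i)) =
      (List.ofFn fun i => w (τ i)).take k ++ w (τ ⟨k, by omega⟩) :: w (τ ⟨k + 1, hk⟩) ::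
        (List.ofFn fun i => w (τ i)).drop (k + 2) := by
    conv_lhs => rw [← List.take_append_drop k (List.ofFn fun i => w (τ i)),
      List.drop_eq_getElem_cons (by simp; omega), List.drop_eq_getElem_cons (by simp; omega)]
    simp
  rw [hsplit, List.prod_append, List.prod_cons, List.prod_cons, ← mul_assoc (w _), hw _ _ hne,
    zero_mul, mul_zero]

section MatrixUnits

variable {A : Type*} [NonUnitalRing A]

/-- The members of a path `s 0, s 1, …` in a system `e` of matrix units, the first of them
multiplied by `B` on the left. -/
def pathEdge (e : ℕ → ℕ → A) (s : ℕ → ℕ) (B : A) : ℕ → A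
  | 0 => B * e (s 0) (s 1)
  | i + 1 => e (s (i + 1)) (s (i + 2))

theorem pathEdge_mul_pathEdge {e : ℕ → ℕ → A}
    (he : ∀ a b c d, e a b * e c d = if b = c then e a d else 0) {s : ℕ → ℕ} {B : A}
    (hB : e (s 0) (s 0) * B = B) {i j : ℕ} (hij : s (i + 1) ≠ s j) :
    pathEdge e s B i * pathEdge e s B j = 0 := by
  have h : ∀ a, e a (s (i + 1)) * pathEdge e s B j = 0 := fun a => by
    cases j with
    | zero => rw [pathEdge, ← hB, ← mul_assoc, ← mul_assoc, he, if_neg hij, zero_mul, zero_mul]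
    | succ j => rw [pathEdge, he, if_neg hij]
  cases i with
  | zero => rw [pathEdge, mul_assoc, h, mul_zero]
  | succ i => rw [pathEdge, h]

theorem prod_pathEdge {F : Type*} [Field F] [Module F A] [IsScalarTower F A A]
    [SMulCommClass F A A] {e : ℕ → ℕ → A}
    (he : ∀ a b c d, e a b * e c d = if b = c then e a d else 0) (s : ℕ → ℕ) (B : A) (m : ℕ) :
    (List.ofFn fun i : Fin (m + 1) => ((pathEdge e s B i : A) : Unitization F A)).prod =
      (B * e (s 0) (s (m + 1)) : A) := by
  induction m with
  | zero => simp [pathEdge]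
  | succ m ih =>
    rw [List.ofFn_succ', List.concat_eq_append, List.prod_append]
    simp only [Fin.val_castSucc, ih, List.prod_singleton, Fin.val_last]
    rw [pathEdge, ← Unitization.inr_mul, mul_assoc, he, if_pos rfl]

/-! ### Values of multilinear polynomials -/

variable {F : Type*} [Field F] [Module F A] [IsScalarTower F A A] [SMulCommClass F A A]

/-- The value of a multilinear polynomial depends only on what is substituted for its variables. -/
theorem IsMultilinearIn.lift_congr {S : Finset ℕ} {p : FreeAlgebra F ℕ} (h : IsMultilinearIn S p)
    {B : Type*} [Ring B] [Algebra F B] {v v' : ℕ → B} (hv : ∀ i ∈ S, v i = v' i) :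
    FreeAlgebra.lift F v p = FreeAlgebra.lift F v' p := by
  obtain ⟨-, c, rfl⟩ := h
  simp only [map_sum, map_smul, map_list_prod, List.map_ofFn, Function.comp_def,
    FreeAlgebra.lift_ι_apply]
  simp only [hv _ (Subtype.prop _)]

theorem IsMultilinearIn.exists_lift_eq {S : Finset ℕ} {p : FreeAlgebra F ℕ}
    (h : IsMultilinearIn S p) (hp : p ≠ 0) {e : ℕ → ℕ → A}
    (he : ∀ a b c d, e a b * e c d = if b = c then e a d else 0) {s : ℕ → ℕ}
    (hs : Set.InjOn s (Set.Iic S.card)) {B : A} (hB : e (s 0) (s 0) * B = B) :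
    ∃ v : ℕ → A, FreeAlgebra.lift F (fun i => (v i : Unitization F A)) p =
      (B * e (s 0) (s S.card) : A) := by
  classical
  obtain ⟨hS, c, rfl⟩ := h
  obtain ⟨σ, hσ⟩ : ∃ σ, c σ ≠ 0 := by
    by_contra! hc
    exact hp (by simp [hc])
  set w := pathEdge e s ((c σ)⁻¹ • B) with hw
  refine ⟨fun i => if hi : i ∈ S then w (σ.symm ⟨i, hi⟩) else 0, ?_⟩
  simp only [map_sum, map_smul, map_list_prod, List.map_ofFn, Function.comp_def,
    FreeAlgebra.lift_ι_apply, Subtype.prop, dite_true, Subtype.coe_eta]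
  rw [Finset.sum_eq_single σ]
  · obtain ⟨m, hm⟩ : ∃ m, S.card = m + 1 := Nat.exists_eq_succ_of_ne_zero hS.card_ne_zero
    have := prod_pathEdge (F := F) he s ((c σ)⁻¹ • B) m
    simp only [Equiv.symm_apply_apply, hw]
    rw [← hm] at this
    rw [this, smul_mul_assoc, Unitization.inr_smul, smul_smul, mul_inv_cancel₀ hσ, one_smul]
  · intro τ _ hτ
    have hzero := prod_ofFn_comp_perm_eq_zero (fun i => (w i : Unitization F A)) ?_
      (τ.trans σ.symm) ?_
    · simp only [Equiv.trans_apply] at hzero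
      rw [hzero, smul_zero]
    rotate_left
    · intro hone
      refine hτ (Equiv.ext fun i => ?_)
      have := Equiv.congr_fun hone i
      simpa [Equiv.symm_apply_eq] using this
    · intro i j hij
      rw [← Unitization.inr_mul, hw, pathEdge_mul_pathEdge he, Unitization.inr_zero]
      · rw [mul_smul_comm, hB]
      · intro hsij
        exact hij (hs (Set.mem_Iic.2 (by omega)) (Set.mem_Iic.2 (by omega)) hsij).symm
  · simp

theorem ne_zero_of_polyImage_ne {p : FreeAlgebra F ℕ} (h : polyImage p A ≠ {0}) : p ≠ 0 := by
  rintro rfl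
  refine h (Set.ext fun a => ?_)
  simp only [polyImage, map_zero, Set.mem_ofPred_eq, exists_const, Set.mem_singleton_iff]
  rw [← Unitization.inr_zero F, Unitization.inr_injective.eq_iff, eq_comm]

end MatrixUnits

/-! ### Block matrix units -/

namespace FinitaryMatrix

variable {R : Type*} [Ring R]

/-- For `n > 0`, the finitary matrix whose `n × n` block in block row `a` and block column `b` is
the identity matrix, and whose other blocks vanish. -/
def blockUnit (R : Type*) [Ring R] (n : ℕ) (hn : 0 < n) (a b : ℕ) : FinitaryMatrix R :=
  ⟨fun i j => if i / n = a ∧ j / n = b ∧ i % n = j % n then 1 else 0, (a + b + 1) * n,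
    fun i j h => if_neg fun ⟨ha, hb, _⟩ => by
      have h' : a + b + 1 ≤ i / n ∨ a + b + 1 ≤ j / n :=
        h.imp (Nat.le_div_iff_mul_le hn).2 (Nat.le_div_iff_mul_le hn).2
      omega⟩

variable {n : ℕ} (hn : 0 < n)

theorem entry_blockUnit (a b i j : ℕ) : (blockUnit R n hn a b).entry i j =
    if i / n = a ∧ j / n = b ∧ i % n = j % n then 1 else 0 := rfl

theorem blockUnit_mul_blockUnit (a b c d : ℕ) :
    blockUnit R n hn a b * blockUnit R n hn c d = if b = c then blockUnit R n hn a d else 0 := by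
  refine ext_entry fun i j => ?_
  rw [entry_mul, finsum_eq_single _ (n * b + i % n)]
  · have h₁ : (n * b + i % n) / n = b := by
      rw [Nat.mul_add_div hn, Nat.div_eq_of_lt (Nat.mod_lt _ hn), add_zero]
    have h₂ : (n * b + i % n) % n = i % n := by simp
    simp only [entry_blockUnit, h₁, h₂]
    split_ifs <;> simp_all [entry_blockUnit]
  · intro k hk
    rw [entry_blockUnit, if_neg, zero_mul]
    rintro ⟨-, hb, hmod⟩
    exact hk (by rw [← hb, hmod, Nat.div_add_mod])

theorem blockUnit_zero_zero_mul {A : FinitaryMatrix R}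
    (hA : ∀ i j, (n ≤ i ∨ n ≤ j) → A.entry i j = 0) : blockUnit R n hn 0 0 * A = A := by
  refine ext_entry fun i j => ?_
  rw [entry_mul, finsum_eq_single _ i]
  · by_cases hi : i < n
    · simp [entry_blockUnit, Nat.div_eq_of_lt hi]
    · simp [hA i j (Or.inl (not_lt.1 hi))]
  · intro k hk
    by_cases hkn : k < n
    · rw [entry_blockUnit, if_neg, zero_mul]
      rintro ⟨hi, -, h⟩
      rw [Nat.mod_eq_of_lt hkn, Nat.mod_eq_of_lt (by simpa [hn.ne'] using hi)] at h
      exact hk h.symm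
    · rw [hA k j (Or.inl (not_lt.1 hkn)), mul_zero]

theorem mul_blockUnit_zero_zero {A : FinitaryMatrix R}
    (hA : ∀ i j, (n ≤ i ∨ n ≤ j) → A.entry i j = 0) : A * blockUnit R n hn 0 0 = A := by
  refine ext_entry fun i j => ?_
  rw [entry_mul, finsum_eq_single _ j]
  · by_cases hj : j < n
    · simp [entry_blockUnit, Nat.div_eq_of_lt hj]
    · simp [hA i j (Or.inr (not_lt.1 hj))]
  · intro k hk
    by_cases hkn : k < n
    · rw [entry_blockUnit, if_neg, mul_zero]
      rintro ⟨-, hj, h⟩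
      rw [Nat.mod_eq_of_lt hkn, Nat.mod_eq_of_lt (by simpa [hn.ne'] using hj)] at h
      exact hk h
    · rw [hA i k (Or.inr (not_lt.1 hkn)), zero_mul]

end FinitaryMatrix

open FinitaryMatrix in
theorem theorem4p3 {F D : Type*} [Field F] [Infinite F] [DivisionRing D] [Algebra F D]
    [Algebra.IsCentral F D] (p p₁ p₂ : FreeAlgebra F ℕ) (S₁ S₂ : Finset ℕ)
    (h₁ : IsMultilinearIn S₁ p₁) (h₂ : IsMultilinearIn S₂ p₂) (hS : Disjoint S₁ S₂)
    (hp : p = p₁ * p₂)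
    (hne₁ : polyImage p₁ (FinitaryMatrix F) ≠ {0})
    (hne₂ : polyImage p₂ (FinitaryMatrix F) ≠ {0}) :
    polyImage p (FinitaryMatrix D) = Set.univ := by
  refine Set.eq_univ_of_forall fun A => ?_
  obtain ⟨n, hA⟩ : ∃ n, ∀ i j, (n + 1 ≤ i ∨ n + 1 ≤ j) → A.entry i j = 0 := by
    obtain ⟨n, hn⟩ := A.exists_bound
    exact ⟨n, fun i j h => hn i j (by omega)⟩
  have hn := n.succ_pos
  have he := blockUnit_mul_blockUnit (R := D) hn
  have hm₁ := h₁.1.card_pos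
  have hm₂ := h₂.1.card_pos
  obtain ⟨v₁, hv₁⟩ := h₁.exists_lift_eq (ne_zero_of_polyImage_ne hne₁) he
    (s := id) Function.injective_id.injOn (blockUnit_zero_zero_mul hn hA)
  -- The path `m, m + 1, …, m + m' - 1, 0`, where `m` and `m'` are the degrees of `p₁` and `p₂`.
  obtain ⟨v₂, hv₂⟩ := h₂.exists_lift_eq (ne_zero_of_polyImage_ne hne₂) he
    (s := fun i => if i < S₂.card then S₁.card + i else 0)
    (fun i hi j hj hij => by
      simp only [Set.mem_Iic] at hi hj
      dsimp only at hij
      split_ifs at hij <;> omega)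
    (B := blockUnit D (n + 1) hn S₁.card S₁.card) (by simp [hm₂, he])
  refine ⟨fun i => if i ∈ S₁ then v₁ i else v₂ i, ?_⟩
  rw [hp, map_mul,
    h₁.lift_congr (v' := fun i => (v₁ i : Unitization F (FinitaryMatrix D)))
      fun i hi => by simp only [if_pos hi],
    h₂.lift_congr (v' := fun i => (v₂ i : Unitization F (FinitaryMatrix D)))
      fun i hi => by simp only [if_neg (Finset.disjoint_right.1 hS hi)],
    hv₁, hv₂, ← Unitization.inr_mul]
  simp [hm₂, he, mul_assoc, mul_blockUnit_zero_zero hn hA]
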